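/- Let $k$ be an algebraically closed field and $k[X]=k[X_1,\dots,X_n]$. A binomial is a polynomial with at most two terms, $\lambda X^u+\mu X^v$ with $\lambda,\mu\in k$, $u,v\in\mathbb N^n$ (so monomials and $0$ are binomials); a binomial ideal is an ideal generated by binomials. For $\delta\subseteq\{1,\dots,n\}$ let $\mathbb Z^\delta=\{w\in\mathbb Z^n : w_i=0 \text{ for all } i\notin\delta\}$ and $\mathfrak p_{\delta^c}=\langle X_j : j\notin\delta\rangle$. For a subgroup $\mathcal L\subseteq\mathbb Z^n$ and a group homomorphism $\rho:\mathcal L\to k^*$ let $$I_{\mathcal L}(\rho)=\langle X^u-\rho(u-v)X^v : u,v\in\mathbb N^n,\ u-v\in\mathcal L\rangle .$$ A $\delta$-mesoprime ideal is an ideal of the form $I_{\mathcal L}(\rho)+\mathfrak p_{\delta^c}$ with $\mathcal L\subseteq\mathbb Z^\delta$ a subgroup and $\rho:\mathcal L\to k^*$ a group homomorphism. A proper ideal $I$ of $k[X]$ is $\delta$-cellular if $I:(\prod_{i\in\delta}X_i)^\infty=I$ and, for every $i\notin\delta$, some power $X_i^{d_i}$ lies in $I$. **Proposition.** Let $\delta\subseteq\{1,\dots,n\}$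 and let $I$ be a $\delta$-cellular binomial ideal of $k[X]$. Then there are a subgroup $\mathcal L\subseteq\mathbb Z^\delta$ and a group homomorphism $\rho:\mathcal L\to k^*$ such that (a) $(I\cap k[X_i : i\in\delta])\,k[X]=I_{\mathcal L}(\rho)$; (b) $I+\mathfrak p_{\delta^c}=I_{\mathcal L}(\rho)+\mathfrak p_{\delta^c}$; (c) $\sqrt{I+\mathfrak p_{\delta^c}}=\sqrt{I_{\mathcal L}(\rho)}+\mathfrak p_{\delta^c}$; (d) $\sqrt I=\sqrt{I_{\mathcal L}(\rho)}+\mathfrak p_{\delta^c}$. In particular, $\sqrt I$ is a $\delta$-mesoprime ideal, and every minimal prime of $I$ is a binomial ideal. -/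

import Mathlib

/-- A binomial is a polynomial with at most two terms, `a X^u + b X^v`, where the scalars
`a`, `b` may vanish; so monomials and `0` are binomials. -/
def IsBinomial {n : ℕ} {k : Type*} [Field k] (f : MvPolynomial (Fin n) k) : Prop :=
  ∃ (u v : Fin n →₀ ℕ) (a b : k),
    f = MvPolynomial.monomial u a + MvPolynomial.monomial v b

/-- A binomial ideal is an ideal generated by binomials. -/
def IsBinomialIdeal {n : ℕ} {k : Type*} [Field k] (I : Ideal (MvPolynomial (Fin n) k)) : Prop :=
  ∃ S : Set (MvPolynomial (Fin n) k), (∀ f ∈ S, IsBinomial f) ∧ I = Ideal.span S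

/-- `I` is a `δ`-cellular ideal: `I` is proper, `I : (∏_{i ∈ δ} X_i)^∞ = I` (only the inclusion
`⊆` has content), and every variable `X_i` with `i ∉ δ` has a power in `I`. -/
structure IsCellular {n : ℕ} {k : Type*} [Field k] (δ : Finset (Fin n))
    (I : Ideal (MvPolynomial (Fin n) k)) : Prop where
  ne_top : I ≠ ⊤
  saturated : ∀ (m : ℕ) (f : MvPolynomial (Fin n) k),
    (∏ i ∈ δ, MvPolynomial.X i) ^ m * f ∈ I → f ∈ I
  nilpotent : ∀ i, i ∉ δ → ∃ d : ℕ, (MvPolynomial.X i) ^ d ∈ I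

/-- The subgroup `ℤ^δ` of `ℤ^n` of the vectors whose coordinates outside `δ` vanish. -/
def zDelta {n : ℕ} (δ : Finset (Fin n)) : AddSubgroup (Fin n → ℤ) where
  carrier := {w | ∀ i, i ∉ δ → w i = 0}
  zero_mem' := fun _ _ => rfl
  add_mem' := fun {a b} ha hb i hi => by simp [ha i hi, hb i hi]
  neg_mem' := fun {a} ha i hi => by simp [ha i hi]

/-- The lattice ideal `I_L(ρ)`, generated by all `X^u - ρ(u - v) X^v` with `u - v ∈ L`. -/
noncomputable def latticeIdeal {n : ℕ} {k : Type*} [Field k] (L : AddSubgroup (Fin n → ℤ))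
    (ρ : Multiplicative L →* kˣ) : Ideal (MvPolynomial (Fin n) k) :=
  Ideal.span {f | ∃ (u v : Fin n →₀ ℕ) (h : (fun i => (u i : ℤ) - (v i : ℤ)) ∈ L),
    f = MvPolynomial.monomial u 1 -
      MvPolynomial.monomial v ((ρ (Multiplicative.ofAdd ⟨_, h⟩) : kˣ) : k)}

/-- The ideal `𝔭_{δᶜ}` generated by the variables `X_j` with `j ∉ δ`. -/
noncomputable def pCompl {n : ℕ} (k : Type*) [Field k] (δ : Finset (Fin n)) :
    Ideal (MvPolynomial (Fin n) k) :=
  Ideal.span {f | ∃ j, j ∉ δ ∧ f = MvPolynomial.X j}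

/-- The ideal `(I ∩ k[X_i : i ∈ δ]) k[X]`: the extension to `k[X]` of the elimination ideal. -/
noncomputable def elimExt {n : ℕ} {k : Type*} [Field k] (δ : Finset (Fin n))
    (I : Ideal (MvPolynomial (Fin n) k)) : Ideal (MvPolynomial (Fin n) k) :=
  Ideal.span {f | f ∈ I ∧ f ∈ MvPolynomial.supported k (δ : Set (Fin n))}

/-- A `δ`-mesoprime ideal is one of the form `I_L(ρ) + 𝔭_{δᶜ}` for a subgroup `L ⊆ ℤ^δ` and a
character `ρ : L → kˣ`. -/
def IsMesoprime {n : ℕ} {k : Type*} [Field k] (δ : Finset (Fin n))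
    (I : Ideal (MvPolynomial (Fin n) k)) : Prop :=
  ∃ (L : AddSubgroup (Fin n → ℤ)) (ρ : Multiplicative L →* kˣ),
    L ≤ zDelta δ ∧ I = latticeIdeal L ρ + pCompl k δ

/-!
The lattice `L` consists of the exponent differences `u - v` of the binomials `X^u - c X^v ∈ I`,
`c ≠ 0`, in the variables of `δ`, and `ρ(u - v) = c`. Monomials in these variables are not zero
divisors modulo `I`, so `c` depends only on `u - v`, and `I_L(ρ) ⊆ I`
(`IsCellular.exists_isBinomialPart`).

Each of the generating binomials of `I` lies in `I_L(ρ)` or in `𝔭_{δᶜ}`: otherwise exactly one of its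
monomials would involve a variable outside `δ`, hence be nilpotent modulo `I`, and so would the
other, a nonzero monomial in the variables of `δ` (`IsBinomialPart.le_sup`). Hence
`I + 𝔭_{δᶜ} = I_L(ρ) + 𝔭_{δᶜ}`. Applying the projection `projDelta`, which kills the variables outside
`δ`, shows that the elimination ideal of `I` extends to `I_L(ρ)` and that
`√(I_L(ρ) + 𝔭_{δᶜ}) = √(I_L(ρ)) + 𝔭_{δᶜ}`. This ideal is `√I`, because `𝔭_{δᶜ} ⊆ √I`.

For the rest, `ρ` extends to a character `σ` of `ℤ^n`, as `kˣ` is divisible, and `I_L(ρ) + 𝔭_{δᶜ}` is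
the kernel of the map `X_i ↦ σ(e_i) [e_i]` (`i ∈ δ`), `X_i ↦ 0` (`i ∉ δ`) to the group algebra of
`ℤ^n / L` (`ker_groupAlgebraMap`). Let `p` be the characteristic exponent of `k`. The group algebra
of an abelian group without `p`-torsion is reduced, by linear independence of characters
(`isReduced_addMonoidAlgebra`), so replacing `L` by the set of all `w` with `p^e w ∈ L` for some `e`
yields the radical. If `P` is a minimal prime of `I`, then `P` is cellular and its own lattice `M` is
saturated because `k` is algebraically closed (`IsBinomialPart.mem_of_nsmul_mem`). The group algebra
of the torsion-free group `ℤ^n / M` is a domain, so `I_M(τ) + 𝔭_{δᶜ}`, for `τ` the character of `P`, is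
a prime between `I` and `P`, and hence is `P`.
-/

/-! ### Characters and group algebras of abelian groups -/

/-- Over an algebraically closed field every character of a subgroup of an abelian group extends
to the whole group, because the group `kˣ` is divisible. -/
theorem exists_unitsHom_comp_eq {k : Type*} [Field k] [IsAlgClosed k] {M G : Type*}
    [AddCommGroup M] [AddCommGroup G] (f : M →+ G) (hf : Function.Injective f)
    (ρ : Multiplicative M →* kˣ) :
    ∃ σ : Multiplicative G →* kˣ, ∀ x, σ (Multiplicative.ofAdd (f x)) =
      ρ (Multiplicative.ofAdd x) := by
  let _ : RootableBy kˣ ℕ := rootableByOfPowLeftSurj _ _ fun {d} hd z => by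
    obtain ⟨y, hy⟩ := IsAlgClosed.exists_pow_nat_eq (z : k) (Nat.pos_of_ne_zero hd)
    have hy0 : y ≠ 0 := by
      rintro rfl
      rw [zero_pow hd] at hy
      exact z.ne_zero hy.symm
    exact ⟨Units.mk0 y hy0, Units.ext (by simpa using hy)⟩
  let _ : DivisibleBy (Additive kˣ) ℕ :=
    { div := fun a n => Additive.ofMul (RootableBy.root a.toMul n)
      div_zero := fun a => congrArg Additive.ofMul (RootableBy.root_zero a.toMul)
      div_cancel := fun {n} a hn => congrArg Additive.ofMul (RootableBy.root_cancel a.toMul hn) }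
  let _ : DivisibleBy (Additive kˣ) ℤ := AddGroup.divisibleByIntOfDivisibleByNat _
  obtain ⟨h, hh⟩ := (Module.Baer.of_divisible (Additive kˣ)).extension_property_addMonoidHom f hf
    (AddMonoidHom.toMultiplicativeLeft.symm ρ)
  exact ⟨AddMonoidHom.toMultiplicativeLeft h, fun x => congrArg Additive.toMul
    (DFunLike.congr_fun hh x)⟩

/-- If `G` has no `p`-torsion, `p` being the characteristic exponent of the algebraically closed
field `k`, then the characters `G → kˣ` separate the points of `G`. -/
theorem exists_unitsHom_ne_one {k : Type*} [Field k] [IsAlgClosed k] (p : ℕ) [ExpChar k p]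
    {G : Type*} [AddCommGroup G] (hG : ∀ g : G, p • g = 0 → g = 0) {g : G} (hg : g ≠ 0) :
    ∃ χ : Multiplicative G →* kˣ, χ (Multiplicative.ofAdd g) ≠ 1 := by
  -- A value `z ≠ 1` allowed for the generator of the cyclic group generated by `g`.
  obtain ⟨z, hz1, hz⟩ : ∃ z : kˣ, z ≠ 1 ∧ ∀ m : ℤ, m • g = 0 → z ^ m = 1 := by
    rcases Nat.eq_zero_or_pos (addOrderOf g) with h0 | hpos
    · obtain ⟨z, hz⟩ := Infinite.exists_notMem_finset (Set.toFinite ({0, 1} : Set k)).toFinset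
      simp only [Set.Finite.mem_toFinset, Set.mem_insert_iff, Set.mem_singleton_iff, not_or] at hz
      refine ⟨Units.mk0 z hz.1, fun h => hz.2 (by simpa using congrArg Units.val h), ?_⟩
      intro m hm
      have : m = 0 := by
        have := addOrderOf_dvd_iff_zsmul_eq_zero.2 hm
        simpa [h0] using this
      simp [this]
    · have hne : (addOrderOf g : k) ≠ 0 := by
        cases ‹ExpChar k p› with
        | zero => exact_mod_cast hpos.ne'
        | prime hp =>
          intro h
          obtain ⟨c, hc⟩ := (CharP.cast_eq_zero_iff k p _).1 h
          have h1 : c • g = 0 := hG _ (by rw [smul_smul, ← hc, addOrderOf_nsmul_eq_zero])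
          have h2 := Nat.le_of_dvd (Nat.pos_of_ne_zero fun h => by simp [h] at hc; simp [hc] at hpos)
            (addOrderOf_dvd_of_nsmul_eq_zero h1)
          have h3 := hp.two_le
          nlinarith
      have : NeZero (addOrderOf g : k) := ⟨hne⟩
      obtain ⟨ζ, hζ⟩ := HasEnoughRootsOfUnity.exists_primitiveRoot k (addOrderOf g)
      have hu := hζ.isUnit hpos.ne'
      have hζ' : IsPrimitiveRoot hu.unit (addOrderOf g) := hζ.isUnit_unit hpos.ne'
      refine ⟨hu.unit, fun h => hg ?_, fun m hm => ?_⟩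
      · rw [h] at hζ'
        exact AddMonoid.addOrderOf_eq_one_iff.1 (hζ'.unique IsPrimitiveRoot.one)
      · exact (hζ'.zpow_eq_one_iff_dvd m).2 (addOrderOf_dvd_iff_zsmul_eq_zero.2 hm)
  obtain ⟨χ, hχ⟩ := exists_unitsHom_comp_eq (QuotientAddGroup.kerLift (zmultiplesHom G g))
    (QuotientAddGroup.kerLift_injective _)
    (AddMonoidHom.toMultiplicativeLeft (QuotientAddGroup.lift _
      (zmultiplesHom (Additive kˣ) (Additive.ofMul z)) (fun m hm => congrArg Additive.ofMul
        (hz m (by simpa using hm)))))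
  refine ⟨χ, ?_⟩
  have := hχ ((1 : ℤ) : ℤ ⧸ (zmultiplesHom G g).ker)
  have h2 : QuotientAddGroup.kerLift (zmultiplesHom G g)
      ((1 : ℤ) : ℤ ⧸ (zmultiplesHom G g).ker) = g := by
    rw [QuotientAddGroup.kerLift_mk]; simp
  rw [h2] at this
  rw [this]
  intro h
  apply hz1
  have h3 : (zmultiplesHom (Additive kˣ) (Additive.ofMul z)) 1 = 0 := congrArg Additive.ofMul h
  simpa using h3

/-- The group algebra of an abelian group without `p`-torsion over an algebraically closed field of
characteristic exponent `p` is reduced: a nilpotent element is killed by all characters, and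
the elements of the group are linearly independent as functions on the characters. -/
theorem isReduced_addMonoidAlgebra {k : Type*} [Field k] [IsAlgClosed k] (p : ℕ) [ExpChar k p]
    {G : Type*} [AddCommGroup G] (hG : ∀ g : G, p • g = 0 → g = 0) :
    IsReduced (AddMonoidAlgebra k G) := by
  refine ⟨fun f hf => ?_⟩
  let ev : G → ((Multiplicative G →* kˣ) →* k) := fun g =>
    (Units.coeHom k).comp (MonoidHom.eval (Multiplicative.ofAdd g))
  have hev : Function.Injective ev := by
    intro a b hab
    by_contra hne
    obtain ⟨χ, hχ⟩ := exists_unitsHom_ne_one (k := k) p hG (sub_ne_zero.2 hne)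
    apply hχ
    have : χ (Multiplicative.ofAdd a) = χ (Multiplicative.ofAdd b) :=
      Units.ext (DFunLike.congr_fun hab χ)
    rw [ofAdd_sub, map_div, this, div_self']
  have hli := (linearIndependent_monoidHom (Multiplicative G →* kˣ) k).comp ev hev
  have hsum : ∑ g ∈ f.coeff.support, f.coeff g •
      ((fun φ : (Multiplicative G →* kˣ) →* k => (φ : (Multiplicative G →* kˣ) → k)) ∘ ev) g
        = 0 := by
    funext χ
    have h0 := (hf.map (AddMonoidAlgebra.lift k k G ((Units.coeHom k).comp χ))).eq_zero
    rw [AddMonoidAlgebra.lift_apply, Finsupp.sum] at h0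
    simpa [Finset.sum_apply, ev] using h0
  have h := linearIndependent_iff'.1 hli _ _ hsum
  ext g
  by_cases hg : g ∈ f.coeff.support
  · simpa using h g hg
  · simpa using hg

section

open MvPolynomial

variable {n : ℕ} {k : Type*} [Field k] {δ : Finset (Fin n)}
  {I : Ideal (MvPolynomial (Fin n) k)}

/-! ### The projection onto the polynomials in the variables of `δ` -/

theorem aeval_ite_monomial {A : Type*} [CommRing A] [Algebra k A] (f : Fin n → A)
    (u : Fin n →₀ ℕ) (a : k) :
    aeval (fun i => if i ∈ δ then f i else 0) (monomial u a) =
      if u.support ⊆ δ then a • u.prod (fun i m => f i ^ m) else 0 := by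
  rw [aeval_monomial, ← Algebra.smul_def]
  split_ifs with hu
  · congr 1
    exact Finset.prod_congr rfl fun i hi => by simp only [if_pos (hu hi)]
  · obtain ⟨i, hi, hiδ⟩ := Finset.not_subset.1 hu
    rw [Finsupp.prod, Finset.prod_eq_zero hi, smul_zero]
    rw [if_neg hiδ, zero_pow (Finsupp.mem_support_iff.1 hi)]

/-- The projection of `k[X]` onto `k[X_i : i ∈ δ]` that sends the other variables to `0`. -/
noncomputable def projDelta (k : Type*) [Field k] (δ : Finset (Fin n)) :
    MvPolynomial (Fin n) k →ₐ[k] MvPolynomial (Fin n) k :=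
  aeval fun i => if i ∈ δ then X i else 0

theorem projDelta_monomial (u : Fin n →₀ ℕ) (a : k) :
    projDelta k δ (monomial u a) = if u.support ⊆ δ then monomial u a else 0 := by
  rw [projDelta, aeval_ite_monomial, monomial_eq, smul_eq_C_mul]

theorem projDelta_of_mem_supported {f : MvPolynomial (Fin n) k}
    (hf : f ∈ supported k (δ : Set (Fin n))) : projDelta k δ f = f := by
  refine (AlgHom.eqOn_adjoin_iff (φ := projDelta k δ) (ψ := AlgHom.id k _)).2 ?_ hf
  rintro _ ⟨i, hi, rfl⟩
  simp [projDelta, Finset.mem_coe.1 hi]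

theorem projDelta_eq_zero {f : MvPolynomial (Fin n) k} (hf : f ∈ pCompl k δ) :
    projDelta k δ f = 0 := by
  refine (Ideal.span_le (I := RingHom.ker (projDelta k δ))).2 ?_ hf
  rintro _ ⟨i, hi, rfl⟩
  simp [projDelta, hi, RingHom.mem_ker]

theorem sub_projDelta_mem (f : MvPolynomial (Fin n) k) : f - projDelta k δ f ∈ pCompl k δ := by
  rw [← Ideal.Quotient.mk_eq_mk_iff_sub_mem]
  refine DFunLike.congr_fun (f := Ideal.Quotient.mkₐ k (pCompl k δ))
    (g := (Ideal.Quotient.mkₐ k (pCompl k δ)).comp (projDelta k δ)) ?_ f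
  refine algHom_ext fun i => ?_
  by_cases hi : i ∈ δ
  · simp [projDelta, hi]
  · simp only [projDelta, AlgHom.comp_apply, aeval_X, if_neg hi, map_zero]
    exact Ideal.Quotient.eq_zero_iff_mem.2 (Ideal.subset_span ⟨i, hi, rfl⟩)

theorem monomial_mem_pCompl {u : Fin n →₀ ℕ} (hu : ¬ u.support ⊆ δ) (a : k) :
    monomial u a ∈ pCompl k δ := by
  simpa [projDelta_monomial, hu] using sub_projDelta_mem (δ := δ) (monomial u a)

theorem monomial_mem_supported {u : Fin n →₀ ℕ} (hu : u.support ⊆ δ) (a : k) :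
    monomial u a ∈ supported k (δ : Set (Fin n)) := by
  by_cases ha : a = 0
  · simp [ha]
  · rw [mem_supported, vars_monomial ha]
    exact_mod_cast hu

/-! ### Cellular ideals, their radicals and minimal primes -/

namespace IsCellular

theorem mem_of_X_mul_mem (hI : IsCellular δ I) {i : Fin n} (hi : i ∈ δ)
    {f : MvPolynomial (Fin n) k} (hf : X i * f ∈ I) : f ∈ I := by
  refine hI.saturated 1 f ?_
  rw [pow_one, ← Finset.prod_erase_mul _ _ hi, mul_assoc]
  exact I.mul_mem_left _ hf

theorem mem_of_monomial_mul_mem (hI : IsCellular δ I) {u : Fin n →₀ ℕ} (hu : u.support ⊆ δ) :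
    ∀ {f : MvPolynomial (Fin n) k}, monomial u 1 * f ∈ I → f ∈ I := by
  classical
  induction u using Finsupp.induction_linear with
  | zero => intro f hf; simpa using hf
  | add u v ihu ihv =>
    intro f hf
    refine ihv (fun i hi => hu ?_) (ihu (fun i hi => hu ?_) (f := monomial v 1 * f) ?_)
    · simp only [Finsupp.mem_support_iff, Finsupp.add_apply] at hi ⊢; omega
    · simp only [Finsupp.mem_support_iff, Finsupp.add_apply] at hi ⊢; omega
    · rwa [← mul_assoc, monomial_mul, one_mul]
  | single i m =>
    rcases Nat.eq_zero_or_pos m with rfl | hm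
    · intro f hf; simpa using hf
    · have hi : i ∈ δ := hu (by simp [hm.ne'])
      clear hu hm
      induction m with
      | zero => intro f hf; simpa using hf
      | succ m ih =>
        intro f hf
        refine ih (hI.mem_of_X_mul_mem hi ?_)
        rwa [← mul_assoc, X, monomial_mul, one_mul, ← Finsupp.single_add, add_comm 1]

theorem monomial_notMem (hI : IsCellular δ I) {u : Fin n →₀ ℕ} (hu : u.support ⊆ δ) {a : k}
    (ha : a ≠ 0) : monomial u a ∉ I := by
  intro h
  refine hI.ne_top ((Ideal.eq_top_iff_one I).2 (hI.mem_of_monomial_mul_mem hu ?_))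
  have := I.mul_mem_left (C a⁻¹) h
  rwa [C_mul_monomial, inv_mul_cancel₀ ha, ← mul_one (monomial u 1)] at this

theorem pCompl_le_radical (hI : IsCellular δ I) : pCompl k δ ≤ I.radical := by
  refine Ideal.span_le.2 ?_
  rintro _ ⟨i, hi, rfl⟩
  exact hI.nilpotent i hi

protected theorem radical (hI : IsCellular δ I) : IsCellular δ I.radical where
  ne_top h := hI.ne_top (Ideal.radical_eq_top.1 h)
  saturated := by
    rintro m f ⟨N, hN⟩
    rw [mul_pow, ← pow_mul] at hN
    exact ⟨N, hI.saturated _ _ hN⟩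
  nilpotent i hi := (hI.nilpotent i hi).imp fun _ hd => Ideal.le_radical hd

/-- Minimal primes of a cellular ideal are cellular: a variable `X_i` with `i ∈ δ` is not a zero
divisor modulo the radical, so it avoids all minimal primes. -/
theorem of_mem_minimalPrimes (hI : IsCellular δ I) {P : Ideal (MvPolynomial (Fin n) k)}
    (hP : P ∈ I.minimalPrimes) : IsCellular δ P where
  ne_top := hP.1.1.ne_top
  saturated m f hf := by
    have := hP.1.1
    refine (this.mem_or_mem hf).resolve_left fun h => ?_
    have hmem : (∏ i ∈ δ, X i : MvPolynomial (Fin n) k) ∈ ⋃ p ∈ I.minimalPrimes, (p : Set _) :=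
      Set.mem_biUnion hP (this.mem_of_pow_mem m h)
    rw [Ideal.iUnion_minimalPrimes] at hmem
    obtain ⟨y, hy, hxy⟩ := hmem
    exact hy (hI.radical.saturated 1 y (by rwa [pow_one]))
  nilpotent i hi := (hI.nilpotent i hi).imp fun _ hd => hP.1.2 hd

end IsCellular

/-! ### The lattice and the character of a cellular ideal -/

/-- `L` and `ρ` record the pure binomials `X^u - c X^v` in the variables of `δ` that lie in `I`:
such a binomial, with `c ≠ 0`, lies in `I` exactly when `u - v ∈ L` and `c = ρ(u - v)`. -/
structure IsBinomialPart (δ : Finset (Fin n)) (I : Ideal (MvPolynomial (Fin n) k))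
    (L : AddSubgroup (Fin n → ℤ)) (ρ : Multiplicative L →* kˣ) : Prop where
  le_zDelta : L ≤ zDelta δ
  latticeIdeal_le : latticeIdeal L ρ ≤ I
  exists_mem : ∀ (u v : Fin n →₀ ℕ) (c : k), u.support ⊆ δ → v.support ⊆ δ → c ≠ 0 →
    monomial u 1 - monomial v c ∈ I →
    ∃ h : (fun i => (u i : ℤ) - (v i : ℤ)) ∈ L, ((ρ (Multiplicative.ofAdd ⟨_, h⟩) : kˣ) : k) = c

namespace IsCellular

/-- If `X^u - c X^v` lies in a cellular ideal, `u` being supported on `δ`, then so does every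
`X^u' - c X^v'` with the same difference of exponents, because the monomials in the variables of
`δ` are not zero divisors modulo the ideal. -/
theorem sub_mem_of_sub_eq (hI : IsCellular δ I) {u v u' v' : Fin n →₀ ℕ} {c : k}
    (hu : u.support ⊆ δ) (h : monomial u 1 - monomial v c ∈ I) (huv : u + v' = u' + v) :
    monomial u' 1 - monomial v' c ∈ I := by
  refine hI.mem_of_monomial_mul_mem hu ?_
  have : monomial u (1 : k) * (monomial u' 1 - monomial v' c) =
      monomial u' 1 * (monomial u 1 - monomial v c) := by
    simp only [mul_sub, monomial_mul, one_mul, huv, add_comm u u']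
  rw [this]
  exact I.mul_mem_left _ h

theorem eq_of_sub_mem (hI : IsCellular δ I) {u v : Fin n →₀ ℕ} {c c' : k}
    (hv : v.support ⊆ δ) (h : monomial u 1 - monomial v c ∈ I)
    (h' : monomial u 1 - monomial v c' ∈ I) : c = c' := by
  by_contra hne
  refine hI.monomial_notMem hv (sub_ne_zero.2 hne) ?_
  have := I.sub_mem h' h
  rwa [sub_sub_sub_cancel_left, ← map_sub] at this

/-- `c` is the coefficient of a binomial `X^u - c X^v ∈ I` in the variables of `δ` whose exponents
differ by `w`. -/
def IsCoeff (δ : Finset (Fin n)) (I : Ideal (MvPolynomial (Fin n) k)) (w : Fin n → ℤ) (c : kˣ) :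
    Prop :=
  ∃ u v : Fin n →₀ ℕ, u.support ⊆ δ ∧ v.support ⊆ δ ∧ (∀ i, (u i : ℤ) - v i = w i) ∧
    monomial u 1 - monomial v (c : k) ∈ I

theorem IsCoeff.sub_mem (hI : IsCellular δ I) {w : Fin n → ℤ} {c : kˣ} (h : IsCoeff δ I w c)
    {u v : Fin n →₀ ℕ} (huv : ∀ i, (u i : ℤ) - v i = w i) :
    monomial u 1 - monomial v (c : k) ∈ I := by
  obtain ⟨u', v', hu', -, hw, hmem⟩ := h
  refine hI.sub_mem_of_sub_eq hu' hmem ?_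
  ext i
  have := hw i
  have := huv i
  simp only [Finsupp.add_apply]
  omega

theorem IsCoeff.unique (hI : IsCellular δ I) {w : Fin n → ℤ} {c c' : kˣ} (h : IsCoeff δ I w c)
    (h' : IsCoeff δ I w c') : c = c' := by
  obtain ⟨u, v, -, hv, hw, hmem⟩ := h
  exact Units.ext (hI.eq_of_sub_mem hv hmem (IsCoeff.sub_mem hI h' hw))

theorem IsCoeff.zero : IsCoeff δ I 0 1 :=
  ⟨0, 0, by simp, by simp, by simp, by simp⟩

theorem IsCoeff.add {w w' : Fin n → ℤ} {c c' : kˣ} (h : IsCoeff δ I w c)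
    (h' : IsCoeff δ I w' c') : IsCoeff δ I (w + w') (c * c') := by
  classical
  obtain ⟨u, v, hu, hv, hw, hmem⟩ := h
  obtain ⟨u', v', hu', hv', hw', hmem'⟩ := h'
  refine ⟨u + u', v + v', Finsupp.support_add.trans (Finset.union_subset hu hu'),
    Finsupp.support_add.trans (Finset.union_subset hv hv'), fun i => ?_, ?_⟩
  · have := hw i
    have := hw' i
    simp only [Finsupp.add_apply, Pi.add_apply, Nat.cast_add]
    omega
  · have : monomial (u + u') (1 : k) - monomial (v + v') ((c * c' : kˣ) : k) =
        monomial u' 1 * (monomial u 1 - monomial v (c : k)) +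
          monomial v (c : k) * (monomial u' 1 - monomial v' (c' : k)) := by
      simp only [mul_sub, monomial_mul, one_mul, mul_one, Units.val_mul, add_comm u u',
        add_comm v u']
      ring
    rw [this]
    exact I.add_mem (I.mul_mem_left _ hmem) (I.mul_mem_left _ hmem')

theorem IsCoeff.neg {w : Fin n → ℤ} {c : kˣ} (h : IsCoeff δ I w c) : IsCoeff δ I (-w) c⁻¹ := by
  obtain ⟨u, v, hu, hv, hw, hmem⟩ := h
  refine ⟨v, u, hv, hu, fun i => ?_, ?_⟩
  · have := hw i
    simp only [Pi.neg_apply]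
    omega
  · have := I.mul_mem_left (C (-(c⁻¹ : kˣ) : k)) hmem
    rw [mul_sub, C_mul_monomial, C_mul_monomial] at this
    simpa [sub_eq_add_neg, add_comm] using this

/-- The exponent differences of the binomials of `I` in the variables of `δ` form a subgroup: the
product of the congruences `X^u ≡ c X^v` and `X^u' ≡ c' X^v'` is a congruence of the same kind. The
coefficient is unique because `I` contains no monomial in these variables. -/
theorem exists_isBinomialPart (hI : IsCellular δ I) :
    ∃ (L : AddSubgroup (Fin n → ℤ)) (ρ : Multiplicative L →* kˣ), IsBinomialPart δ I L ρ := by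
  let L : AddSubgroup (Fin n → ℤ) :=
    { carrier := {w | ∃ c, IsCoeff δ I w c}
      zero_mem' := ⟨1, IsCoeff.zero⟩
      add_mem' := fun ⟨_, h⟩ ⟨_, h'⟩ => ⟨_, h.add h'⟩
      neg_mem' := fun ⟨_, h⟩ => ⟨_, h.neg⟩ }
  choose r hr using fun w : L => w.2
  let ρ : Multiplicative L →* kˣ :=
    { toFun := fun w => r w.toAdd
      map_one' := IsCoeff.unique hI (hr 0) IsCoeff.zero
      map_mul' := fun a b => IsCoeff.unique hI (hr (a.toAdd + b.toAdd))
        ((hr a.toAdd).add (hr b.toAdd)) }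
  refine ⟨L, ρ, ?_, ?_, ?_⟩
  · rintro w ⟨c, u, v, hu, hv, hw, -⟩ i hi
    rw [← hw i, Finsupp.notMem_support_iff.1 fun h => hi (hu h),
      Finsupp.notMem_support_iff.1 fun h => hi (hv h), sub_self]
  · refine Ideal.span_le.2 ?_
    rintro _ ⟨u, v, h, rfl⟩
    exact IsCoeff.sub_mem hI (hr ⟨_, h⟩) fun _ => rfl
  · intro u v c hu hv hc hmem
    have h : IsCoeff δ I (fun i => (u i : ℤ) - (v i : ℤ)) (Units.mk0 c hc) :=
      ⟨u, v, hu, hv, fun _ => rfl, hmem⟩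
    exact ⟨⟨_, h⟩, congrArg Units.val (IsCoeff.unique hI (hr ⟨_, _, h⟩) h)⟩

end IsCellular

/-! ### Elimination and the ideals `I_L(ρ) + 𝔭_{δᶜ}` -/

theorem sub_mem_latticeIdeal {L : AddSubgroup (Fin n → ℤ)} {ρ : Multiplicative L →* kˣ}
    {u v : Fin n →₀ ℕ} (h : (fun i => (u i : ℤ) - (v i : ℤ)) ∈ L) :
    monomial u 1 - monomial v ((ρ (Multiplicative.ofAdd ⟨_, h⟩) : kˣ) : k) ∈ latticeIdeal L ρ :=
  Ideal.subset_span ⟨u, v, h, rfl⟩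

/-- A generator `X^u - ρ(u - v) X^v` with `u - v ∈ ℤ^δ` is a monomial multiple of a binomial of
the same kind in the variables of `δ`. -/
theorem latticeIdeal_le_elimExt {L : AddSubgroup (Fin n → ℤ)} {ρ : Multiplicative L →* kˣ}
    (hL : L ≤ zDelta δ) : latticeIdeal L ρ ≤ elimExt δ (latticeIdeal L ρ) := by
  refine Ideal.span_le.2 ?_
  rintro _ ⟨u, v, h, rfl⟩
  have hu : u ⊓ v + (u - v) = u := by
    ext i; simp only [Finsupp.add_apply, Finsupp.inf_apply, Finsupp.tsub_apply]; omega
  have hv : u ⊓ v + (v - u) = v := by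
    ext i; simp only [Finsupp.add_apply, Finsupp.inf_apply, Finsupp.tsub_apply]; omega
  have hd : (fun i => (u i : ℤ) - (v i : ℤ)) =
      fun i => ((u - v) i : ℤ) - ((v - u) i : ℤ) := by
    funext i; simp only [Finsupp.tsub_apply]; omega
  have h' := h
  rw [hd] at h'
  have hsupp : ∀ i, i ∉ δ → u i = v i := fun i hi => by
    have : (u i : ℤ) - v i = 0 := hL h i hi
    omega
  have hρ : ρ (Multiplicative.ofAdd ⟨_, h⟩) = ρ (Multiplicative.ofAdd ⟨_, h'⟩) := by
    congr 3
  have hmul : monomial u 1 - monomial v ((ρ (Multiplicative.ofAdd ⟨_, h⟩) : kˣ) : k) =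
      monomial (u ⊓ v) 1 * (monomial (u - v) 1 -
        monomial (v - u) ((ρ (Multiplicative.ofAdd ⟨_, h'⟩) : kˣ) : k)) := by
    rw [mul_sub, monomial_mul, monomial_mul, one_mul, one_mul, hu, hv, hρ]
  rw [SetLike.mem_coe, hmul]
  refine Ideal.mul_mem_left _ _ (Ideal.subset_span ⟨sub_mem_latticeIdeal h', ?_⟩)
  refine Subalgebra.sub_mem _ (monomial_mem_supported (fun i hi => ?_) _)
    (monomial_mem_supported (fun i hi => ?_) _) <;>
  · by_contra hiδ
    have := hsupp i hiδ
    simp only [Finsupp.mem_support_iff, Finsupp.tsub_apply] at hi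
    omega

theorem projDelta_mem_latticeIdeal {L : AddSubgroup (Fin n → ℤ)} {ρ : Multiplicative L →* kˣ}
    (hL : L ≤ zDelta δ) {f : MvPolynomial (Fin n) k} (hf : f ∈ latticeIdeal L ρ) :
    projDelta k δ f ∈ latticeIdeal L ρ := by
  have h : elimExt δ (latticeIdeal L ρ) ≤ (latticeIdeal L ρ).comap (projDelta k δ) := by
    refine Ideal.span_le.2 ?_
    rintro g ⟨hg, hgs⟩
    rwa [SetLike.mem_coe, Ideal.mem_comap, projDelta_of_mem_supported hgs]
  exact h (latticeIdeal_le_elimExt hL hf)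

/-- A binomial ideal `J` contained in a cellular ideal `I` lies in `I_L(ρ) + 𝔭_{δᶜ}`, where `L` and
`ρ` belong to `I`: if exactly one of the two monomials of a binomial in `I` involves a variable
outside `δ`, then the other one is nilpotent modulo `I`, which is impossible for a monomial in the
variables of `δ`. -/
theorem IsBinomialPart.le_sup {J : Ideal (MvPolynomial (Fin n) k)} (hbin : IsBinomialIdeal J)
    (hJI : J ≤ I) (hI : IsCellular δ I) {L : AddSubgroup (Fin n → ℤ)} {ρ : Multiplicative L →* kˣ}
    (h : IsBinomialPart δ I L ρ) : J ≤ latticeIdeal L ρ ⊔ pCompl k δ := by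
  obtain ⟨S, hS, hJS⟩ := hbin
  have hmixed : ∀ (u v : Fin n →₀ ℕ) (a b : k), u.support ⊆ δ → ¬ v.support ⊆ δ →
      monomial u a + monomial v b ∈ I →
      monomial u a + monomial v b ∈ latticeIdeal L ρ ⊔ pCompl k δ := by
    intro u v a b hu hv hf
    have hvp := monomial_mem_pCompl hv b
    have ha : a = 0 := by
      by_contra ha
      refine hI.radical.monomial_notMem hu ha ?_
      have := I.radical.sub_mem (Ideal.le_radical hf) (hI.pCompl_le_radical hvp)
      rwa [add_sub_cancel_right] at this
    rw [ha, map_zero, zero_add]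
    exact Ideal.mem_sup_right hvp
  rw [hJS]
  refine Ideal.span_le.2 fun f hf => ?_
  have hfI : f ∈ I := hJI (hJS ▸ Ideal.subset_span hf)
  obtain ⟨u, v, a, b, rfl⟩ := hS f hf
  by_cases hu : u.support ⊆ δ <;> by_cases hv : v.support ⊆ δ
  · by_cases ha : a = 0
    · rw [ha, map_zero, zero_add] at hfI ⊢
      have hb : b = 0 := by
        by_contra hb
        exact hI.monomial_notMem hv hb hfI
      simp [hb]
    by_cases hb : b = 0
    · rw [hb, map_zero, add_zero] at hfI
      exact absurd hfI (hI.monomial_notMem hu ha)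
    refine Ideal.mem_sup_left ?_
    have hmem : monomial u 1 - monomial v (-(a⁻¹ * b)) ∈ I := by
      have := I.mul_mem_left (C a⁻¹) hfI
      rwa [mul_add, C_mul_monomial, C_mul_monomial, inv_mul_cancel₀ ha, ← sub_neg_eq_add,
        ← map_neg] at this
    obtain ⟨hL, hρ⟩ := h.exists_mem u v _ hu hv (by simp [ha, hb]) hmem
    have := (latticeIdeal L ρ).mul_mem_left (C a) (sub_mem_latticeIdeal (ρ := ρ) hL)
    rw [hρ, mul_sub, C_mul_monomial, C_mul_monomial, mul_neg, mul_inv_cancel_left₀ ha, mul_one,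
      map_neg, sub_neg_eq_add] at this
    exact this
  · exact hmixed u v a b hu hv hfI
  · rw [SetLike.mem_coe, add_comm]
    rw [add_comm] at hfI
    exact hmixed v u b a hv hu hfI
  · exact Ideal.mem_sup_right (add_mem (monomial_mem_pCompl hu a) (monomial_mem_pCompl hv b))

theorem IsBinomialPart.elimExt_eq (hbin : IsBinomialIdeal I) (hI : IsCellular δ I)
    {L : AddSubgroup (Fin n → ℤ)} {ρ : Multiplicative L →* kˣ} (h : IsBinomialPart δ I L ρ) :
    elimExt δ I = latticeIdeal L ρ := by
  apply le_antisymm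
  · refine Ideal.span_le.2 ?_
    rintro f ⟨hf, hfs⟩
    obtain ⟨g, hg, q, hq, rfl⟩ := Submodule.mem_sup.1 (h.le_sup hbin le_rfl hI hf)
    rw [← projDelta_of_mem_supported hfs, map_add, projDelta_eq_zero hq, add_zero]
    exact projDelta_mem_latticeIdeal h.le_zDelta hg
  · exact (latticeIdeal_le_elimExt h.le_zDelta).trans
      (Ideal.span_mono fun f hf => ⟨h.latticeIdeal_le hf.1, hf.2⟩)

/-- If a power of `f` lies in `I_L(ρ) + 𝔭_{δᶜ}`, then its projection, the same power of
`projDelta k δ f`, lies in `I_L(ρ)`. -/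
theorem radical_latticeIdeal_sup {L : AddSubgroup (Fin n → ℤ)} {ρ : Multiplicative L →* kˣ}
    (hL : L ≤ zDelta δ) : (latticeIdeal L ρ ⊔ pCompl k δ).radical =
      (latticeIdeal L ρ).radical ⊔ pCompl k δ := by
  apply le_antisymm
  · rintro f ⟨m, hm⟩
    obtain ⟨g, hg, q, hq, hgq⟩ := Submodule.mem_sup.1 hm
    rw [← add_sub_cancel (projDelta k δ f) f]
    refine add_mem (Ideal.mem_sup_left ⟨m, ?_⟩) (Ideal.mem_sup_right (sub_projDelta_mem f))
    rw [← map_pow, ← hgq, map_add, projDelta_eq_zero hq, add_zero]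
    exact projDelta_mem_latticeIdeal hL hg
  · exact sup_le (Ideal.radical_mono le_sup_left) (le_sup_right.trans Ideal.le_radical)

theorem IsCellular.radical_sup_pCompl (hI : IsCellular δ I) :
    (I ⊔ pCompl k δ).radical = I.radical :=
  le_antisymm (Ideal.radical_le_radical_iff.2 (sup_le Ideal.le_radical hI.pCompl_le_radical))
    (Ideal.radical_mono le_sup_left)

/-! ### Embedding the quotient by `I_L(ρ) + 𝔭_{δᶜ}` into a group algebra -/

/-- The restriction to a subgroup `L` of a character of `ℤ^n`. -/
def restrictChar (L : AddSubgroup (Fin n → ℤ)) (σ : Multiplicative (Fin n → ℤ) →* kˣ) :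
    Multiplicative L →* kˣ :=
  σ.comp (AddMonoidHom.toMultiplicative L.subtype)

/-- The `k`-algebra map `k[X] → k[ℤ^n / L]` that sends `X_i` to `σ(e_i) [e_i]` for `i ∈ δ` and to
`0` for `i ∉ δ`. -/
noncomputable def groupAlgebraMap (δ : Finset (Fin n)) (L : AddSubgroup (Fin n → ℤ))
    (σ : Multiplicative (Fin n → ℤ) →* kˣ) :
    MvPolynomial (Fin n) k →ₐ[k] AddMonoidAlgebra k ((Fin n → ℤ) ⧸ L) :=
  aeval fun i => if i ∈ δ then AddMonoidAlgebra.single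
    (QuotientAddGroup.mk (Pi.single i 1)) (σ (Multiplicative.ofAdd (Pi.single i 1)) : k) else 0

theorem groupAlgebraMap_monomial (L : AddSubgroup (Fin n → ℤ)) (σ : Multiplicative (Fin n → ℤ) →* kˣ)
    (u : Fin n →₀ ℕ) (a : k) :
    groupAlgebraMap δ L σ (monomial u a) = if u.support ⊆ δ then AddMonoidAlgebra.single
      (QuotientAddGroup.mk fun i => (u i : ℤ))
      (a * (σ (Multiplicative.ofAdd fun i => (u i : ℤ)) : k)) else 0 := by
  rw [groupAlgebraMap, aeval_ite_monomial]
  congr 1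
  rw [← smul_eq_mul, ← AddMonoidAlgebra.smul_single]
  congr 1
  induction u using Finsupp.induction_linear with
  | zero =>
    have : (fun i => (((0 : Fin n →₀ ℕ) i : ℕ) : ℤ)) = 0 := by funext i; simp
    rw [this]
    simp [AddMonoidAlgebra.one_def]
  | add u v hu hv =>
    have : (fun i => (((u + v) i : ℕ) : ℤ)) = (fun i => (u i : ℤ)) + fun i => (v i : ℤ) := by
      funext i; simp
    rw [Finsupp.prod_add_index' (fun _ => pow_zero _) (fun _ _ _ => pow_add _ _ _), hu, hv, this,
      AddMonoidAlgebra.single_mul_single, ofAdd_add, map_mul, Units.val_mul, QuotientAddGroup.mk_add]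
  | single i m =>
    have : (fun j => ((Finsupp.single i m j : ℕ) : ℤ)) = m • Pi.single i (1 : ℤ) := by
      funext j
      by_cases h : j = i
      · subst h; simp
      · simp [h]
    rw [Finsupp.prod_single_index (by exact pow_zero _), this, AddMonoidAlgebra.single_pow, ofAdd_nsmul,
      map_pow, Units.val_pow_eq_pow_val, QuotientAddGroup.mk_nsmul]

/-- The ideal `I_L(σ|_L) + 𝔭_{δᶜ}` is the kernel of `groupAlgebraMap`. A linear left inverse of the
induced map on the quotient sends a class of `ℤ^n / L` to the multiple `σ(s)⁻¹ X^s`, where `s` is a chosen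
nonnegative representative supported on `δ`. -/
theorem ker_groupAlgebraMap {L : AddSubgroup (Fin n → ℤ)} (hL : L ≤ zDelta δ)
    (σ : Multiplicative (Fin n → ℤ) →* kˣ) :
    RingHom.ker (groupAlgebraMap δ L σ) = latticeIdeal L (restrictChar L σ) ⊔ pCompl k δ := by
  classical
  set Q := latticeIdeal L (restrictChar L σ) ⊔ pCompl k δ
  apply le_antisymm
  · let c : (Fin n →₀ ℕ) → (Fin n → ℤ) ⧸ L := fun u => QuotientAddGroup.mk fun i => (u i : ℤ)
    let B : (Fin n → ℤ) ⧸ L → MvPolynomial (Fin n) k ⧸ Q := fun g =>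
      if h : ∃ u : Fin n →₀ ℕ, u.support ⊆ δ ∧ c u = g then
        Ideal.Quotient.mkₐ k Q (monomial h.choose
          ((σ (Multiplicative.ofAdd fun i => (h.choose i : ℤ)) : k)⁻¹)) else 0
    let T : AddMonoidAlgebra k ((Fin n → ℤ) ⧸ L) →ₗ[k] MvPolynomial (Fin n) k ⧸ Q :=
      (Finsupp.linearCombination k B).comp (AddMonoidAlgebra.coeffLinearEquiv k).toLinearMap
    have hT : T.comp (groupAlgebraMap δ L σ).toLinearMap = (Ideal.Quotient.mkₐ k Q).toLinearMap := by
      refine MvPolynomial.linearMap_ext fun u => LinearMap.ext fun a => ?_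
      simp only [LinearMap.comp_apply, AlgHom.toLinearMap_apply, groupAlgebraMap_monomial]
      split_ifs with hu
      · have h : ∃ u' : Fin n →₀ ℕ, u'.support ⊆ δ ∧ c u' = c u := ⟨u, hu, rfl⟩
        have hTs : T (AddMonoidAlgebra.single (c u)
            (a * (σ (Multiplicative.ofAdd fun i => (u i : ℤ)) : k))) =
            (a * (σ (Multiplicative.ofAdd fun i => (u i : ℤ)) : k)) • B (c u) := by
          rw [LinearMap.comp_apply]
          exact Finsupp.linearCombination_single k _ _
        refine hTs.trans ?_
        simp only [B]
        rw [dif_pos h]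
        obtain ⟨-, hs⟩ := h.choose_spec
        generalize h.choose = s at hs ⊢
        rw [← map_smul]
        refine (Ideal.Quotient.eq.2 ?_).symm
        have hmem : (fun i => (u i : ℤ) - (s i : ℤ)) ∈ L := by
          have := QuotientAddGroup.eq.1 hs
          rwa [neg_add_eq_sub] at this
        have := Q.mul_mem_left (C a) (Ideal.mem_sup_left
          (sub_mem_latticeIdeal (ρ := restrictChar L σ) hmem))
        rw [mul_sub, C_mul_monomial, C_mul_monomial, mul_one] at this
        have hsub : (restrictChar L σ) (Multiplicative.ofAdd ⟨_, hmem⟩) =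
            σ (Multiplicative.ofAdd fun i => (u i : ℤ)) /
              σ (Multiplicative.ofAdd fun i => (s i : ℤ)) := by
          rw [← map_div]; rfl
        rw [hsub, Units.val_div_eq_div_val, div_eq_mul_inv, ← mul_assoc] at this
        rwa [smul_monomial, smul_eq_mul]
      · rw [map_zero]
        exact (Ideal.Quotient.eq_zero_iff_mem.2
          (Ideal.mem_sup_right (monomial_mem_pCompl hu a))).symm
    intro f hf
    refine Ideal.Quotient.eq_zero_iff_mem.1 ?_
    have := LinearMap.congr_fun hT f
    rw [LinearMap.comp_apply, AlgHom.toLinearMap_apply, RingHom.mem_ker.1 hf, map_zero] at this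
    exact this.symm
  · refine sup_le (Ideal.span_le.2 ?_) (Ideal.span_le.2 ?_)
    · rintro _ ⟨u, v, h, rfl⟩
      have hsupp : u.support ⊆ δ ↔ v.support ⊆ δ := by
        have : ∀ i, i ∉ δ → u i = v i := fun i hi => by
          have : (u i : ℤ) - v i = 0 := hL h i hi
          omega
        constructor <;>
        · intro hs i hi
          by_contra hiδ
          have h1 := this i hiδ
          rw [Finsupp.mem_support_iff] at hi
          exact hiδ (hs (Finsupp.mem_support_iff.2 (by omega)))
      rw [SetLike.mem_coe, RingHom.mem_ker, map_sub, groupAlgebraMap_monomial, groupAlgebraMap_monomial,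
        sub_eq_zero]
      simp only [hsupp]
      have hq : (QuotientAddGroup.mk fun i => (u i : ℤ) : (Fin n → ℤ) ⧸ L) =
          QuotientAddGroup.mk fun i => (v i : ℤ) := by
        rw [eq_comm, QuotientAddGroup.eq, neg_add_eq_sub]
        exact h
      have hσ : restrictChar L σ (Multiplicative.ofAdd ⟨_, h⟩) *
          σ (Multiplicative.ofAdd fun i => (v i : ℤ)) =
          σ (Multiplicative.ofAdd fun i => (u i : ℤ)) := by
        rw [← eq_div_iff_mul_eq', ← map_div]; rfl
      rw [hq, one_mul, ← Units.val_mul, hσ]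
    · rintro _ ⟨i, hi, rfl⟩
      simp [groupAlgebraMap, hi, RingHom.mem_ker]

theorem exists_restrictChar_eq [IsAlgClosed k] (L : AddSubgroup (Fin n → ℤ))
    (ρ : Multiplicative L →* kˣ) : ∃ σ, restrictChar L σ = ρ := by
  obtain ⟨σ, hσ⟩ := exists_unitsHom_comp_eq L.subtype L.subtype_injective ρ
  exact ⟨σ, MonoidHom.ext fun x => hσ x.toAdd⟩

/-! ### The radical -/

/-- The elements of `ℤ^n` that some power of `p` multiplies into `L`. -/
def pSaturation (p : ℕ) (L : AddSubgroup (Fin n → ℤ)) : AddSubgroup (Fin n → ℤ) where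
  carrier := {w | ∃ e : ℕ, p ^ e • w ∈ L}
  zero_mem' := ⟨0, by simp⟩
  add_mem' := by
    rintro a b ⟨e, he⟩ ⟨e', he'⟩
    refine ⟨e + e', ?_⟩
    rw [smul_add]
    refine L.add_mem ?_ ?_
    · rw [pow_add, mul_comm, mul_smul]
      exact L.nsmul_mem he _
    · rw [pow_add, mul_smul]
      exact L.nsmul_mem he' _
  neg_mem' := by
    rintro a ⟨e, he⟩
    exact ⟨e, by rw [smul_neg]; exact L.neg_mem he⟩

theorem pSaturation_le_zDelta {p : ℕ} (hp : p ≠ 0) {L : AddSubgroup (Fin n → ℤ)}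
    (hL : L ≤ zDelta δ) : pSaturation p L ≤ zDelta δ := by
  rintro w ⟨e, he⟩ i hi
  simpa [hp] using hL he i hi

theorem latticeIdeal_le_latticeIdeal {L L' : AddSubgroup (Fin n → ℤ)} (h : L ≤ L')
    (σ : Multiplicative (Fin n → ℤ) →* kˣ) :
    latticeIdeal L (restrictChar L σ) ≤ latticeIdeal L' (restrictChar L' σ) :=
  Ideal.span_mono fun _ ⟨u, v, hw, hf⟩ => ⟨u, v, h hw, hf⟩

/-- For `q` a power of the characteristic exponent, the `q`-th power of `X^u - σ(u - v) X^v` is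
`X^(q u) - σ(q (u - v)) X^(q v)`. -/
theorem latticeIdeal_pSaturation_le_radical (p : ℕ) [ExpChar k p] (L : AddSubgroup (Fin n → ℤ))
    (σ : Multiplicative (Fin n → ℤ) →* kˣ) :
    latticeIdeal (pSaturation p L) (restrictChar _ σ) ≤
      (latticeIdeal L (restrictChar L σ)).radical := by
  refine Ideal.span_le.2 ?_
  rintro _ ⟨u, v, ⟨e, he⟩, rfl⟩
  refine ⟨p ^ e, ?_⟩
  have : ExpChar (MvPolynomial (Fin n) k) p := inferInstance
  rw [sub_pow_expChar_pow, monomial_pow, monomial_pow, one_pow]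
  have hd : (fun i => (((p ^ e • u) i : ℕ) : ℤ) - (((p ^ e • v) i : ℕ) : ℤ)) =
      p ^ e • fun i => (u i : ℤ) - (v i : ℤ) := by
    funext i; simp [mul_sub]
  refine Ideal.subset_span ⟨_, _, hd ▸ he, ?_⟩
  rw [← Units.val_pow_eq_pow_val]
  congr 3
  refine (map_pow σ _ _).symm.trans (congrArg σ ?_)
  exact (congrArg Multiplicative.ofAdd hd).symm

/-- The radical of `I_L(σ|_L) + 𝔭_{δᶜ}` is obtained by replacing `L` by its `p`-saturation, for `p`
the characteristic exponent: `ℤ^n / pSaturation p L` has no `p`-torsion, so its group algebra is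
reduced. -/
theorem radical_latticeIdeal_restrictChar_sup [IsAlgClosed k] (p : ℕ) [ExpChar k p]
    {L : AddSubgroup (Fin n → ℤ)} (hL : L ≤ zDelta δ) (σ : Multiplicative (Fin n → ℤ) →* kˣ) :
    (latticeIdeal L (restrictChar L σ) ⊔ pCompl k δ).radical =
      latticeIdeal (pSaturation p L) (restrictChar _ σ) ⊔ pCompl k δ := by
  have hL' := pSaturation_le_zDelta (expChar_ne_zero k p) hL
  have hle : L ≤ pSaturation p L := fun w hw => ⟨0, by simpa using hw⟩
  apply le_antisymm
  · refine (Ideal.radical_mono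
      (sup_le_sup_right (latticeIdeal_le_latticeIdeal hle σ) _)).trans ?_
    rw [← ker_groupAlgebraMap hL' σ]
    have hred : IsReduced (AddMonoidAlgebra k ((Fin n → ℤ) ⧸ pSaturation p L)) := by
      refine isReduced_addMonoidAlgebra p fun g => ?_
      induction g using QuotientAddGroup.induction_on with
      | H w =>
        intro hg
        rw [← QuotientAddGroup.mk_nsmul, QuotientAddGroup.eq_zero_iff] at hg
        obtain ⟨e, he⟩ := hg
        rw [QuotientAddGroup.eq_zero_iff]
        exact ⟨e + 1, by rwa [pow_succ, mul_smul]⟩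
    rintro f ⟨m, hm⟩
    rw [RingHom.mem_ker, map_pow] at hm
    exact RingHom.mem_ker.2 (eq_zero_of_pow_eq_zero hm)
  · exact sup_le ((latticeIdeal_pSaturation_le_radical p L σ).trans
      (Ideal.radical_mono le_sup_left)) (le_sup_right.trans Ideal.le_radical)

/-! ### Prime cellular ideals -/

/-- The lattice of a prime cellular ideal is saturated: modulo the prime, `X^u / X^v` is a root of
`T^d - c`, and all roots of this polynomial lie in the algebraically closed field `k`. -/
theorem IsBinomialPart.mem_of_nsmul_mem [IsAlgClosed k] {P : Ideal (MvPolynomial (Fin n) k)}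
    [P.IsPrime] (hP : IsCellular δ P) {L : AddSubgroup (Fin n → ℤ)} {ρ : Multiplicative L →* kˣ}
    (h : IsBinomialPart δ P L ρ) {d : ℕ} (hd : d ≠ 0) {w : Fin n → ℤ} (hw : d • w ∈ L) :
    w ∈ L := by
  have hwδ : ∀ i, i ∉ δ → w i = 0 := fun i hi => by simpa [hd] using h.le_zDelta hw i hi
  -- `u` and `v` are the positive and the negative part of `w`.
  let u : Fin n →₀ ℕ := Finsupp.equivFunOnFinite.symm fun i => (w i).toNat
  let v : Fin n →₀ ℕ := Finsupp.equivFunOnFinite.symm fun i => (-w i).toNat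
  have huv : (fun i => (u i : ℤ) - (v i : ℤ)) = w := by
    funext i
    change ((w i).toNat : ℤ) - ((-w i).toNat : ℤ) = w i
    omega
  have hu : u.support ⊆ δ := fun i hi => by
    by_contra hiδ
    exact Finsupp.mem_support_iff.1 hi (by simp [u, hwδ i hiδ])
  have hv : v.support ⊆ δ := fun i hi => by
    by_contra hiδ
    exact Finsupp.mem_support_iff.1 hi (by simp [v, hwδ i hiδ])
  have hduv : (fun i => (((d • u) i : ℕ) : ℤ) - (((d • v) i : ℕ) : ℤ)) = d • w := by
    rw [← huv]
    funext i; simp [mul_sub]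
  have hmem := h.latticeIdeal_le (sub_mem_latticeIdeal (ρ := ρ) (hduv ▸ hw))
  generalize ((ρ (Multiplicative.ofAdd ⟨_, hduv ▸ hw⟩) : kˣ) : k) = c at hmem
  let K := FractionRing (MvPolynomial (Fin n) k ⧸ P)
  let π : MvPolynomial (Fin n) k →+* K :=
    (algebraMap (MvPolynomial (Fin n) k ⧸ P) K).comp (Ideal.Quotient.mk P)
  have hπ : ∀ f, π f = 0 ↔ f ∈ P := fun f => by
    rw [RingHom.comp_apply, FaithfulSMul.algebraMap_eq_zero_iff, Ideal.Quotient.eq_zero_iff_mem]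
  have hv0 : π (monomial v 1) ≠ 0 := fun h0 => hP.monomial_notMem hv one_ne_zero ((hπ _).1 h0)
  have hroot : ((Polynomial.X ^ d - Polynomial.C c).map (π.comp C)).IsRoot
      (π (monomial u 1) / π (monomial v 1)) := by
    have h0 := (hπ _).2 hmem
    have hs : monomial (d • u) (1 : k) - monomial (d • v) c =
        monomial u 1 ^ d - C c * monomial v 1 ^ d := by
      rw [monomial_pow, monomial_pow, one_pow, C_mul_monomial, mul_one]
    rw [hs, map_sub, map_mul, map_pow, map_pow, sub_eq_zero] at h0
    simp only [Polynomial.map_sub, Polynomial.map_pow, Polynomial.map_X, Polynomial.map_C,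
      Polynomial.IsRoot.def, Polynomial.eval_sub, Polynomial.eval_pow, Polynomial.eval_X,
      Polynomial.eval_C, RingHom.comp_apply]
    rw [div_pow, h0, mul_div_cancel_right₀ _ (pow_ne_zero d hv0), sub_self]
  obtain ⟨ζ, hζ⟩ := (IsAlgClosed.splits _).mem_range_of_isRoot
    (Polynomial.X_pow_sub_C_ne_zero (Nat.pos_of_ne_zero hd) c) hroot
  have hmem' : monomial u 1 - monomial v ζ ∈ P := by
    rw [← hπ, map_sub, sub_eq_zero, ← mul_one ζ, ← C_mul_monomial, map_mul]
    rw [eq_div_iff hv0] at hζ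
    exact hζ.symm
  have hζ0 : ζ ≠ 0 := by
    rintro rfl
    rw [map_zero, sub_zero] at hmem'
    exact hP.monomial_notMem hu one_ne_zero hmem'
  exact huv ▸ (h.exists_mem u v ζ hu hv hζ0 hmem').1

/-- If `ℤ^n / L` is torsion-free, then its group algebra is a domain and `I_L(ρ) + 𝔭_{δᶜ}` is
prime. -/
theorem isPrime_latticeIdeal_sup [IsAlgClosed k] {L : AddSubgroup (Fin n → ℤ)}
    (hL : L ≤ zDelta δ) (hsat : ∀ (d : ℕ) (w : Fin n → ℤ), d ≠ 0 → d • w ∈ L → w ∈ L)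
    (ρ : Multiplicative L →* kˣ) : (latticeIdeal L ρ ⊔ pCompl k δ).IsPrime := by
  obtain ⟨σ, rfl⟩ := exists_restrictChar_eq L ρ
  rw [← ker_groupAlgebraMap hL σ]
  have : IsAddTorsionFree ((Fin n → ℤ) ⧸ L) := by
    refine ⟨fun d hd => ?_⟩
    refine (injective_iff_map_eq_zero (nsmulAddMonoidHom (α := (Fin n → ℤ) ⧸ L) d)).2 fun g => ?_
    induction g using QuotientAddGroup.induction_on with
    | H w =>
      intro hg
      rw [nsmulAddMonoidHom_apply, ← QuotientAddGroup.mk_nsmul,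
        QuotientAddGroup.eq_zero_iff] at hg
      exact (QuotientAddGroup.eq_zero_iff w).2 (hsat d w hd hg)
  exact RingHom.ker_isPrime (groupAlgebraMap δ L σ)

theorem isBinomialIdeal_latticeIdeal_sup (L : AddSubgroup (Fin n → ℤ))
    (ρ : Multiplicative L →* kˣ) : IsBinomialIdeal (latticeIdeal L ρ ⊔ pCompl k δ) := by
  refine ⟨_, ?_, (Ideal.span_union _ _).symm⟩
  rintro _ (⟨u, v, h, rfl⟩ | ⟨i, -, rfl⟩)
  · exact ⟨u, v, 1, _, by rw [sub_eq_add_neg, ← map_neg]⟩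
  · exact ⟨Finsupp.single i 1, 0, 1, 0, by rw [map_zero, add_zero, X]⟩

end

/-! ### The structure of cellular binomial ideals -/

theorem proposition4p2 {k : Type*} [Field k] [IsAlgClosed k] {n : ℕ} (δ : Finset (Fin n))
    (I : Ideal (MvPolynomial (Fin n) k)) (hbin : IsBinomialIdeal I) (hcell : IsCellular δ I) :
    (∃ (L : AddSubgroup (Fin n → ℤ)) (ρ : Multiplicative L →* kˣ), L ≤ zDelta δ ∧
      elimExt δ I = latticeIdeal L ρ ∧
      I + pCompl k δ = latticeIdeal L ρ + pCompl k δ ∧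
      (I + pCompl k δ).radical = (latticeIdeal L ρ).radical + pCompl k δ ∧
      I.radical = (latticeIdeal L ρ).radical + pCompl k δ) ∧
    IsMesoprime δ I.radical ∧
    ∀ P ∈ I.minimalPrimes, IsBinomialIdeal P := by
  simp only [Submodule.add_eq_sup]
  obtain ⟨L, ρ, h⟩ := hcell.exists_isBinomialPart
  have hsup : I ⊔ pCompl k δ = latticeIdeal L ρ ⊔ pCompl k δ :=
    le_antisymm (sup_le (h.le_sup hbin le_rfl hcell) le_sup_right)
      (sup_le_sup_right h.latticeIdeal_le _)
  have hrad : I.radical = (latticeIdeal L ρ ⊔ pCompl k δ).radical := by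
    rw [← hsup, hcell.radical_sup_pCompl]
  refine ⟨⟨L, ρ, h.le_zDelta, h.elimExt_eq hbin hcell, hsup, ?_, ?_⟩, ?_, fun P hP => ?_⟩
  · rw [hsup, radical_latticeIdeal_sup h.le_zDelta]
  · rw [hrad, radical_latticeIdeal_sup h.le_zDelta]
  · obtain ⟨p, hp⟩ := ExpChar.exists k
    obtain ⟨σ, rfl⟩ := exists_restrictChar_eq L ρ
    exact ⟨pSaturation p L, restrictChar _ σ,
      pSaturation_le_zDelta (expChar_ne_zero k p) h.le_zDelta,
      hrad.trans (radical_latticeIdeal_restrictChar_sup p h.le_zDelta σ)⟩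
  · have hPprime := hP.1.1
    have hPcell := hcell.of_mem_minimalPrimes hP
    obtain ⟨M, τ, hM⟩ := hPcell.exists_isBinomialPart
    have hprime := isPrime_latticeIdeal_sup hM.le_zDelta
      (fun d w hd hw => hM.mem_of_nsmul_mem hPcell hd hw) τ
    have hle : latticeIdeal M τ ⊔ pCompl k δ ≤ P :=
      sup_le hM.latticeIdeal_le (hPcell.pCompl_le_radical.trans hPprime.radical.le)
    -- `P` is minimal over `I`, so it equals the prime `I_M(τ) + 𝔭_{δᶜ}` lying between the two.
    rw [le_antisymm (hP.2 ⟨hprime, hM.le_sup hbin hP.1.2 hPcell⟩ hle) hle]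
    exact isBinomialIdeal_latticeIdeal_sup M τ
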